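/- **Setting.** Let $\mathcal T$ be a set of records and $\mathcal D=\mathcal T^*$ the set of datasets; $|D|$ is the number of records of $D$. Two datasets are *neighbors* if they have the same size and differ in exactly one position, or if one is a copy of the other with one extra record. A *mechanism family* $\mathcal M=(\mathcal M_\kappa)_{\kappa\in\mathbb N}$ assigns to every $\kappa$ and every dataset $D$ a probability distribution $\mathcal M_\kappa(D)$ on $\{0,1\}^*$. A family $A=(A_\kappa)_\kappa$ of probabilistic functions $\{0,1\}^*\to\{0,1\}^*$ is *non-uniform PPT* if one probabilistic Turing machine with fair coins, given $1^\kappa$, an advice that depends only on $\kappa$ and has length polynomial in $\kappa$, and $x$, always halts in time polynomial in $\kappa+|x|$ and outputs a string distributed as $A_\kappa(x)$ (uniform PPT functions are the case of empty advice). A function $\mathsf{neg}:\mathbb N\to\mathbb R$ is *negligible* if $\kappa^n\,\mathsf{neg}(\kappa)\to0$ for every $n$. Distributions $\mu,\nu$ are $\varepsilon$-indistinguishable, $\mu\approx_\varepsilon\nu$, if $\mu(S)\le e^{\varepsilon}\nu(S)$ and $\nu(S)\le e^{\varepsilon}\mu(S)$ for all $S$; a mechanism $\mathcal M_\kappa$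 is $\varepsilon$-DP if $\mathcal M_\kappa(D_1)\approx_\varepsilon\mathcal M_\kappa(D_2)$ for all neighbors $D_1,D_2$. Let $(\varepsilon_\kappa)_{\kappa\in\mathbb N}$ be a sequence of real numbers. * $\mathcal M$ is *$\varepsilon_\kappa$-IndCDP* if there is a negligible $\mathsf{neg}$ such that for all non-uniform PPT $\Omega$, all polynomials $p$, all sufficiently large $\kappa$ and all neighbors $D_1,D_2$ of size at most $p(\kappa)$, $$\Pr[\Omega_\kappa(\mathcal M_\kappa(D_1))=1]\le e^{\varepsilon_\kappa}\Pr[\Omega_\kappa(\mathcal M_\kappa(D_2))=1]+\mathsf{neg}(\kappa).$$ * $\mathcal M$ is *$\varepsilon_\kappa$-SimCDP* if there are a family $(\mathcal M'_\kappa)_\kappa$ with each $\mathcal M'_\kappa$ $\varepsilon_\kappa$-DP and a negligible $\mathsf{neg}$ such that for all non-uniform PPT $\Omega$, all polynomials $p$, all sufficiently large $\kappa$ and all $D$ of size at most $p(\kappa)$, $$\Pr[\Omega_\kappa(\mathcal M_\kappa(D))=1]-\Pr[\Omega_\kappa(\mathcal M'_\kappa(D))=1]\le\mathsf{neg}(\kappa).$$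 * Let $\mathsf{Agg}$ be a class of families $\mathsf{agg}=(\mathsf{agg}_\kappa)_\kappa$ of (possibly randomized) maps $\mathcal D\to\{0,1\}^*$. $\mathcal M$ is *$(\mathsf{Agg},\varepsilon_\kappa)$-computational zero-knowledge private* if there are $\mathsf{agg}\in\mathsf{Agg}$, a non-uniform PPT simulator $\mathsf{Sim}$ and a negligible $\mathsf{neg}$ such that for all non-uniform PPT $\Omega$, all polynomials $p$, all sufficiently large $\kappa$ and all neighbors $D_1,D_2$ of size at most $p(\kappa)$, the numbers $a=\Pr[\Omega_\kappa(\mathcal M_\kappa(D_1))=1]$ and $b=\Pr[\Omega_\kappa(\mathsf{Sim}_\kappa(\mathsf{agg}_\kappa(D_2)))=1]$ satisfy $a\le e^{\varepsilon_\kappa}b+\mathsf{neg}(\kappa)$ and $b\le e^{\varepsilon_\kappa}a+\mathsf{neg}(\kappa)$. A privacy definition satisfies *convexity* if, whenever $\mathcal M^1$ and $\mathcal M^2$ satisfy it and $p\in[0,1]$, the family that runs $\mathcal M^1_\kappa(D)$ with probability $p$ and $\mathcal M^2_\kappa(D)$ with probability $1-p$ satisfies it. It satisfies *PPT post-processing*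 if, whenever $\mathcal M$ satisfies it and $f$ is non-uniform PPT, the family $D\mapsto f_\kappa(\mathcal M_\kappa(D))$ satisfies it. **Proposition.** (1) $\varepsilon_\kappa$-IndCDP satisfies convexity and PPT post-processing. (2) $\varepsilon_\kappa$-SimCDP satisfies convexity and PPT post-processing. (3) For every $\mathsf{Agg}$, $(\mathsf{Agg},\varepsilon_\kappa)$-computational zero-knowledge privacy satisfies PPT post-processing. It satisfies convexity for every $\mathsf{Agg}$ that is directed in the following sense (for instance, for a single fixed aggregate, $\mathsf{Agg}=\{\mathsf{agg}\}$): for all $\mathsf{agg}^1,\mathsf{agg}^2\in\mathsf{Agg}$ there are $\mathsf{agg}\in\mathsf{Agg}$ and non-uniform PPT $g^1,g^2$ such that $g^i_\kappa(\mathsf{agg}_\kappa(D))$ has the same distribution as $\mathsf{agg}^i_\kappa(D)$ for $i=1,2$ and all $\kappa$, $D$. -/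

import Mathlib

namespace CompDP

open scoped ENNReal

/-- Finite bit strings: outputs of mechanisms, inputs and outputs of machines. -/
abbrev Str : Type := List Bool

/-! ### Probabilistic polynomial-time Turing machines -/

/-- A probabilistic Turing machine, in Mathlib's multi-stack presentation `Turing.TM2` of Turing
machines, with binary stacks. As usual it has two transition functions `prog false` and
`prog true`; at every step a fresh fair coin decides which one is applied. -/
structure ProbTM where
  /-- index type of the stacks -/
  K : Type
  [decK : DecidableEq K]
  [finK : Fintype K]
  /-- labels -/
  Lab : Type
  [finLab : Fintype Lab]
  /-- internal states -/
  St : Type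
  [finSt : Fintype St]
  /-- the label at which the computation starts -/
  start : Lab
  /-- the initial internal state -/
  init : St
  /-- the stack that initially holds the security parameter in unary -/
  secStack : K
  /-- the stack that initially holds the input -/
  inStack : K
  sec_ne_in : secStack ≠ inStack
  /-- the stack from which the output is read after halting -/
  outStack : K
  /-- the two transition functions -/
  prog : Bool → Lab → Turing.TM2.Stmt (fun _ : K => Bool) Lab St

attribute [instance] ProbTM.decK ProbTM.finK ProbTM.finLab ProbTM.finSt

namespace ProbTM

/-- Configurations: label (`none` when halted), internal state and stacks. -/
abbrev Cfg (M : ProbTM) : Type := Turing.TM2.Cfg (fun _ : M.K => Bool) M.Lab M.St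

/-- The initial configuration for security parameter `κ`, advice `z` and input `x`. The advice is a
tuple of strings, one for each stack that does not hold the input or the security parameter; a
machine without advice is the case where all of them are empty. -/
def initCfg (M : ProbTM) (κ : ℕ) (z : M.K → Str) (x : Str) : M.Cfg where
  l := some M.start
  var := M.init
  stk := fun k =>
    if k = M.inStack then x
    else if k = M.secStack then List.replicate κ true
    else z k

/-- One step: toss a fair coin and apply the corresponding transition function. A halted
configuration stays as it is. -/
noncomputable def step (M : ProbTM) (c : M.Cfg) : PMF M.Cfg :=
  match c.l with
  | none => PMF.pure c
  | some l => (PMF.uniformOfFintype Bool).map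
      fun b => Turing.TM2.stepAux (M.prog b l) c.var c.stk

/-- The distribution of the configuration after `t` steps. -/
noncomputable def run (M : ProbTM) : ℕ → M.Cfg → PMF M.Cfg
  | 0, c => PMF.pure c
  | t + 1, c => (M.step c).bind (M.run t)

/-- Started with security parameter `κ`, advice `z` and input `x`, the machine halts within `t`
steps whatever the coins are, and its output has distribution `μ`. -/
def OutputsWithin (M : ProbTM) (κ : ℕ) (z : M.K → Str) (x : Str) (t : ℕ) (μ : PMF Str) : Prop :=
  (∀ c ∈ (M.run t (M.initCfg κ z x)).support, c.l = none) ∧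
    (M.run t (M.initCfg κ z x)).map (fun c => c.stk M.outStack) = μ

end ProbTM

/-- The family `A κ` of probabilistic functions on bit strings is computable by a non-uniform
probabilistic polynomial-time Turing machine: a single machine gets `1^κ`, an advice depending only
on `κ` and of length polynomial in `κ`, and the input `x`; it halts in time polynomial in
`κ + |x|`, with output distributed as `A κ x`. -/
def IsNonuniformPPT (A : ℕ → Str → PMF Str) : Prop :=
  ∃ (M : ProbTM) (z : ℕ → M.K → Str) (a t : Polynomial ℕ),
    (∀ κ k, (z κ k).length ≤ a.eval κ) ∧
    ∀ κ x, M.OutputsWithin κ (z κ) x (t.eval (κ + x.length)) (A κ x)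

/-! ### Mechanisms -/

section
variable {T : Type*}

/-- A family of privacy mechanisms indexed by the security parameter: for each `κ`, a dataset
(a finite sequence of records) is mapped to a distribution over bit strings. -/
abbrev Mech (T : Type*) : Type _ := ℕ → List T → PMF Str

/-- The datasets differ only in one record: either they have the same size and differ in exactly
one position, or one is a copy of the other with one extra record. -/
def Neighbor (D₁ D₂ : List T) : Prop :=
  (∃ l r t t', t ≠ t' ∧ D₁ = l ++ t :: r ∧ D₂ = l ++ t' :: r) ∨
  (∃ l r t, D₁ = l ++ t :: r ∧ D₂ = l ++ r) ∨
  (∃ l r t, D₂ = l ++ t :: r ∧ D₁ = l ++ r)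

/-- `ε`-indistinguishability of two distributions. -/
def Indist (ε : ℝ) (μ ν : PMF Str) : Prop :=
  ∀ S : Set Str,
    μ.toOuterMeasure S ≤ ENNReal.ofReal (Real.exp ε) * ν.toOuterMeasure S ∧
    ν.toOuterMeasure S ≤ ENNReal.ofReal (Real.exp ε) * μ.toOuterMeasure S

/-- `ε`-differential privacy of a single mechanism. -/
def IsDP (ε : ℝ) (M : List T → PMF Str) : Prop :=
  ∀ D₁ D₂, Neighbor D₁ D₂ → Indist ε (M D₁) (M D₂)

/-- The probability that the probabilistic algorithm `A` outputs `1` on a sample of `μ`. -/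
noncomputable def prOne (A : Str → PMF Str) (μ : PMF Str) : ℝ :=
  ((μ.bind A) [true]).toReal

/-- Negligible functions: they converge to zero faster than the inverse of any polynomial. -/
def Negligible (neg : ℕ → ℝ) : Prop :=
  Asymptotics.SuperpolynomialDecay Filter.atTop (fun κ : ℕ => (κ : ℝ)) neg

/-- Indistinguishability-based computational differential privacy. -/
def IndCDP (ε : ℕ → ℝ) (M : Mech T) : Prop :=
  ∃ neg : ℕ → ℝ, Negligible neg ∧
    ∀ A, IsNonuniformPPT A → ∀ p : Polynomial ℕ, ∀ᶠ κ in Filter.atTop,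
      ∀ D₁ D₂ : List T, D₁.length ≤ p.eval κ → D₂.length ≤ p.eval κ → Neighbor D₁ D₂ →
        prOne (A κ) (M κ D₁) ≤ Real.exp (ε κ) * prOne (A κ) (M κ D₂) + neg κ

/-- Simulation-based computational differential privacy. -/
def SimCDP (ε : ℕ → ℝ) (M : Mech T) : Prop :=
  ∃ M' : Mech T, (∀ κ, IsDP (ε κ) (M' κ)) ∧
    ∃ neg : ℕ → ℝ, Negligible neg ∧
      ∀ A, IsNonuniformPPT A → ∀ p : Polynomial ℕ, ∀ᶠ κ in Filter.atTop,
        ∀ D : List T, D.length ≤ p.eval κ →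
          prOne (A κ) (M κ D) - prOne (A κ) (M' κ D) ≤ neg κ

/-- Computational zero-knowledge privacy with respect to a model `Agg` of aggregate information
(a class of families of possibly randomized algorithms on datasets): for some `agg ∈ Agg` and some
polynomial-time simulator `Sim`, for neighboring `D₁` and `D₂`, the output of the mechanism on `D₁`
and the output of `Sim` on `agg(D₂)` are `ε`-indistinguishable, in both directions, for
computationally bounded distinguishers. -/
def CZKPrivate (Agg : Set (Mech T)) (ε : ℕ → ℝ) (M : Mech T) : Prop :=
  ∃ agg ∈ Agg, ∃ Sim : ℕ → Str → PMF Str, IsNonuniformPPT Sim ∧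
    ∃ neg : ℕ → ℝ, Negligible neg ∧
      ∀ A, IsNonuniformPPT A → ∀ p : Polynomial ℕ, ∀ᶠ κ in Filter.atTop,
        ∀ D₁ D₂ : List T, D₁.length ≤ p.eval κ → D₂.length ≤ p.eval κ → Neighbor D₁ D₂ →
          prOne (A κ) (M κ D₁) ≤
              Real.exp (ε κ) * prOne (A κ) ((agg κ D₂).bind (Sim κ)) + neg κ ∧
          prOne (A κ) ((agg κ D₂).bind (Sim κ)) ≤
              Real.exp (ε κ) * prOne (A κ) (M κ D₁) + neg κ

/-- Any two aggregates of the class can be recovered, each in polynomial time, from a third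
aggregate of the class. One-element classes are of this kind. -/
def AggDirected (Agg : Set (Mech T)) : Prop :=
  ∀ a₁ ∈ Agg, ∀ a₂ ∈ Agg, ∃ a ∈ Agg, ∃ g₁ g₂ : ℕ → Str → PMF Str,
    IsNonuniformPPT g₁ ∧ IsNonuniformPPT g₂ ∧
      ∀ κ D, (a κ D).bind (g₁ κ) = a₁ κ D ∧ (a κ D).bind (g₂ κ) = a₂ κ D

/-! ### Privacy axioms -/

/-- A coin that shows `true` with probability `p`. -/
noncomputable def biasedCoin (p : unitInterval) : PMF Bool :=
  PMF.ofFintype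
    (fun b => cond b (ENNReal.ofReal (p : ℝ)) (ENNReal.ofReal (1 - (p : ℝ)))) (by
      rw [Fintype.sum_bool, cond_true, cond_false, ← ENNReal.ofReal_add p.2.1 (by linarith [p.2.2])]
      simp)

/-- The mechanism that runs `M₁` with probability `p` and `M₂` with probability `1 - p`. -/
noncomputable def mix (p : unitInterval) (M₁ M₂ : Mech T) : Mech T :=
  fun κ D => (biasedCoin p).bind fun b => cond b (M₁ κ D) (M₂ κ D)

/-- The mechanism that applies `f` to the output of `M`. -/
noncomputable def postProcess (f : ℕ → Str → PMF Str) (M : Mech T) : Mech T :=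
  fun κ D => (M κ D).bind (f κ)

/-- The convexity axiom for a privacy definition. -/
def SatisfiesConvexity (Def : Mech T → Prop) : Prop :=
  ∀ M₁ M₂ : Mech T, Def M₁ → Def M₂ → ∀ p : unitInterval, Def (mix p M₁ M₂)

/-- The post-processing axiom for a privacy definition, restricted to functions computable in
probabilistic polynomial time (which may depend on the security parameter and use advice; those
of a uniform machine are the case of empty advice). -/
def SatisfiesPPTPostProcessing (Def : Mech T → Prop) : Prop :=
  ∀ M : Mech T, Def M → ∀ f : ℕ → Str → PMF Str, IsNonuniformPPT f → Def (postProcess f M)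

end

end CompDP

/-!
Post-processing by `f` turns a distinguisher into its composition with `f`, so it rests on the
closure of non-uniform PPT under composition; for differential privacy itself it holds for every
`f`. Convexity follows by averaging the inequalities of the two mechanisms.

In the zero-knowledge case the simulator of the mixture has to toss a coin of arbitrary real bias
itself. With the first `κ` binary digits of the bias in its advice it tosses a coin whose bias is
wrong by at most `2 ^ (-κ)`. As `e ^ ε_κ` need not be polynomially bounded, this error must not be
multiplied by it. It is therefore made on the mechanism in one inequality, which is averaged with
the simulator's coin, and on the simulator in the other, which is averaged with the exact coin.
-/

namespace CompDP

open Turing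

namespace ProbTM

variable {M N : ProbTM}

/-- `M.Evals c t μ`: from the configuration `c` the machine `M` halts within `t` steps whatever the
coins are, and its output has distribution `μ`. This is `OutputsWithin` for an arbitrary initial
configuration, as an inductive predicate so that one can induct on the run. -/
inductive Evals (M : ProbTM) : M.Cfg → ℕ → PMF Str → Prop
  | halt (v : M.St) (S : M.K → Str) (t : ℕ) : Evals M ⟨none, v, S⟩ t (PMF.pure (S M.outStack))
  | step {l : M.Lab} {v : M.St} {S : M.K → Str} {t : ℕ} {ν : Bool → PMF Str}
      (h : ∀ b, Evals M (TM2.stepAux (M.prog b l) v S) t (ν b)) :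
      Evals M ⟨some l, v, S⟩ (t + 1) ((PMF.uniformOfFintype Bool).bind ν)

theorem run_halted (v : M.St) (S : M.K → Str) (t : ℕ) :
    M.run t ⟨none, v, S⟩ = PMF.pure ⟨none, v, S⟩ := by
  induction t with
  | zero => rfl
  | succ t ih => rw [run, step, PMF.pure_bind, ih]

theorem run_succ_label (l : M.Lab) (v : M.St) (S : M.K → Str) (t : ℕ) :
    M.run (t + 1) ⟨some l, v, S⟩ = (PMF.uniformOfFintype Bool).bind
      fun b => M.run t (TM2.stepAux (M.prog b l) v S) := by
  rw [run, step, PMF.bind_map]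
  rfl

theorem evals_iff_run {c : M.Cfg} {t : ℕ} {μ : PMF Str} :
    M.Evals c t μ ↔ (∀ c' ∈ (M.run t c).support, c'.l = none) ∧
      (M.run t c).map (fun c' => c'.stk M.outStack) = μ := by
  constructor
  · intro h
    induction h with
    | halt => simp [run_halted, PMF.pure_map]
    | step _ ih =>
      rw [run_succ_label, PMF.map_bind]
      refine ⟨fun c' hc' => ?_, congrArg _ (funext fun b => (ih b).2)⟩
      obtain ⟨b, -, hb⟩ := (PMF.mem_support_bind_iff _ _ _).1 hc'
      exact (ih b).1 c' hb
  · rintro ⟨hhalt, rfl⟩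
    induction t generalizing c with
    | zero =>
      obtain ⟨_, v, S⟩ := c
      obtain rfl : _ = none := hhalt _ (by rw [run, PMF.mem_support_pure_iff])
      rw [run, PMF.pure_map]
      exact .halt v S 0
    | succ t ih =>
      obtain ⟨_ | l, v, S⟩ := c
      · rw [run_halted, PMF.pure_map]
        exact .halt v S _
      · rw [run_succ_label] at hhalt ⊢
        rw [PMF.map_bind]
        exact .step fun b => ih fun c' hc' =>
          hhalt c' ((PMF.mem_support_bind_iff _ _ _).2 ⟨b, by simp, hc'⟩)

theorem outputsWithin_iff_evals {κ : ℕ} {z : M.K → Str} {x : Str} {t : ℕ} {μ : PMF Str} :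
    M.OutputsWithin κ z x t μ ↔ M.Evals (M.initCfg κ z x) t μ :=
  evals_iff_run.symm

theorem Evals.mono {c : M.Cfg} {t t' : ℕ} {μ : PMF Str} (h : M.Evals c t μ) (ht : t ≤ t') :
    M.Evals c t' μ := by
  induction h generalizing t' with
  | halt v S => exact .halt v S t'
  | step _ ih =>
    obtain ⟨t', rfl⟩ := Nat.exists_eq_add_of_le' (Nat.one_le_of_lt ht)
    exact .step fun b => ih b (Nat.le_of_succ_le_succ ht)

theorem OutputsWithin.mono {κ : ℕ} {z : M.K → Str} {x : Str} {t t' : ℕ} {μ : PMF Str}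
    (h : M.OutputsWithin κ z x t μ) (ht : t ≤ t') : M.OutputsWithin κ z x t' μ :=
  outputsWithin_iff_evals.2 ((outputsWithin_iff_evals.1 h).mono ht)

theorem Evals.step_const {l : M.Lab} {v : M.St} {S : M.K → Str} {t : ℕ} {μ : PMF Str}
    (h : ∀ b, M.Evals (TM2.stepAux (M.prog b l) v S) t μ) : M.Evals ⟨some l, v, S⟩ (t + 1) μ := by
  simpa only [PMF.bind_const] using Evals.step (ν := fun _ => μ) h

/-- The number of push instructions of a statement, which bounds the growth of the stacks when the
statement is executed. -/
def pushCount {K Lab St : Type} : TM2.Stmt (fun _ : K => Bool) Lab St → ℕ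
  | .push _ _ q => pushCount q + 1
  | .peek _ _ q => pushCount q
  | .pop _ _ q => pushCount q
  | .load _ q => pushCount q
  | .branch _ q₁ q₂ => max (pushCount q₁) (pushCount q₂)
  | .goto _ => 0
  | .halt => 0

theorem length_stk_stepAux_le {K Lab St : Type} [DecidableEq K]
    (q : TM2.Stmt (fun _ : K => Bool) Lab St) (v : St) (S : K → Str) (k : K) :
    ((TM2.stepAux q v S).stk k).length ≤ (S k).length + pushCount q := by
  induction q generalizing v S with
  | push k' f q ih =>
    refine (ih v _).trans ?_
    rcases eq_or_ne k k' with rfl | hk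
    · rw [Function.update_self, List.length_cons, pushCount]
      omega
    · rw [Function.update_of_ne hk, pushCount]
      omega
  | peek k' f _ ih => exact ih _ S
  | pop k' f q ih =>
    refine (ih _ _).trans (Nat.add_le_add_right ?_ _)
    rcases eq_or_ne k k' with rfl | hk
    · simp
    · simp [hk]
  | load f _ ih => exact ih _ S
  | branch f q₁ q₂ ih₁ ih₂ =>
    cases hf : f v
    · simpa [hf, pushCount] using (ih₂ v S).trans (Nat.add_le_add_left (le_max_right ..) _)
    · simpa [hf, pushCount] using (ih₁ v S).trans (Nat.add_le_add_left (le_max_left ..) _)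
  | goto f => simp
  | halt => simp

/-- The largest number of push instructions in a statement of the program. -/
def maxPushCount (M : ProbTM) : ℕ :=
  Finset.univ.sup fun i : Bool × M.Lab => pushCount (M.prog i.1 i.2)

theorem pushCount_prog_le (b : Bool) (l : M.Lab) : pushCount (M.prog b l) ≤ M.maxPushCount :=
  Finset.le_sup (f := fun i : Bool × M.Lab => pushCount (M.prog i.1 i.2)) (Finset.mem_univ (b, l))

theorem Evals.length_le {c : M.Cfg} {t : ℕ} {μ : PMF Str} (h : M.Evals c t μ) {y : Str}
    (hy : y ∈ μ.support) : y.length ≤ (c.stk M.outStack).length + M.maxPushCount * t := by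
  induction h with
  | halt =>
    obtain rfl := (PMF.mem_support_pure_iff _ _).1 hy
    exact Nat.le_add_right _ _
  | @step l v S t ν _ ih =>
    obtain ⟨b, -, hb⟩ := (PMF.mem_support_bind_iff _ _ _).1 hy
    have hstep := length_stk_stepAux_le (M.prog b l) v S M.outStack
    have hpush := M.pushCount_prog_le b l
    have hrest := ih b hb
    rw [Nat.mul_succ]
    dsimp only
    omega

end ProbTM

/-- Where the components of the machine `N` are found in a larger machine with stacks `K`, labels
`Lab` and internal states `St`, and what the larger machine executes when `N` halts. -/
structure Placement (N : ProbTM) (K Lab St : Type) where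
  /-- the stack of the larger machine that plays the role of a stack of `N` -/
  stack : N.K → K
  stack_injective : Function.Injective stack
  /-- the label of the larger machine that plays the role of a label of `N` -/
  label : N.Lab → Lab
  /-- the internal state of `N` stored in a state of the larger machine -/
  get : St → N.St
  /-- replaces the stored internal state of `N` -/
  set : St → N.St → St
  get_set : ∀ s v, get (set s v) = v
  /-- the statement executed in place of `halt` -/
  exit : TM2.Stmt (fun _ : K => Bool) Lab St

namespace Placement

section

variable {N : ProbTM} {K Lab St : Type}

/-- The translation of the statements of `N` into statements of the larger machine. -/
def tr (P : Placement N K Lab St) :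
    TM2.Stmt (fun _ : N.K => Bool) N.Lab N.St → TM2.Stmt (fun _ : K => Bool) Lab St
  | .push k f q => .push (P.stack k) (fun s => f (P.get s)) (P.tr q)
  | .peek k f q => .peek (P.stack k) (fun s a => P.set s (f (P.get s) a)) (P.tr q)
  | .pop k f q => .pop (P.stack k) (fun s a => P.set s (f (P.get s) a)) (P.tr q)
  | .load f q => .load (fun s => P.set s (f (P.get s))) (P.tr q)
  | .branch f q₁ q₂ => .branch (fun s => f (P.get s)) (P.tr q₁) (P.tr q₂)
  | .goto f => .goto fun s => P.label (f (P.get s))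
  | .halt => P.exit

variable [DecidableEq K]

theorem update_extend (P : Placement N K Lab St) (s : N.K → Str) (F : K → Str) (k : N.K) (x : Str) :
    Function.update (Function.extend P.stack s F) (P.stack k) x =
      Function.extend P.stack (Function.update s k x) F := by
  funext k'
  by_cases hk' : ∃ j, P.stack j = k'
  · obtain ⟨j, rfl⟩ := hk'
    simp [P.stack_injective.extend_apply, Function.update_apply, P.stack_injective.eq_iff]
  · rw [Function.update_of_ne fun h => hk' ⟨k, h.symm⟩, Function.extend_apply' _ _ _ hk',
      Function.extend_apply' _ _ _ hk']

/-- The configuration of the larger machine, in the internal state `V` and with contents `F` of the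
stacks that do not belong to `N`, when `N` has the configuration `c`. A halted configuration
becomes the one reached after the exit statement. -/
noncomputable def liftCfg (P : Placement N K Lab St) (F : K → Str) (V : St) (c : N.Cfg) :
    TM2.Cfg (fun _ : K => Bool) Lab St :=
  c.l.elim (TM2.stepAux P.exit V (Function.extend P.stack c.stk F))
    fun l => ⟨some (P.label l), V, Function.extend P.stack c.stk F⟩

theorem exists_stepAux_tr_eq_liftCfg (P : Placement N K Lab St) (F : K → Str)
    (q : TM2.Stmt (fun _ : N.K => Bool) N.Lab N.St) (V : St) (s : N.K → Str) :
    ∃ V', P.get V' = (TM2.stepAux q (P.get V) s).var ∧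
      TM2.stepAux (P.tr q) V (Function.extend P.stack s F) =
        P.liftCfg F V' (TM2.stepAux q (P.get V) s) := by
  induction q generalizing V s with
  | push k f q ih =>
    simp only [tr, TM2.stepAux, P.stack_injective.extend_apply, update_extend]
    exact ih V _
  | peek k f q ih =>
    simpa only [tr, TM2.stepAux, P.stack_injective.extend_apply, P.get_set] using
      ih (P.set V (f (P.get V) (s k).head?)) s
  | pop k f q ih =>
    simpa only [tr, TM2.stepAux, P.stack_injective.extend_apply, update_extend, P.get_set] using
      ih (P.set V (f (P.get V) (s k).head?)) (Function.update s k (s k).tail)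
  | load f q ih =>
    simpa only [tr, TM2.stepAux, P.get_set] using ih (P.set V (f (P.get V))) s
  | branch f q₁ q₂ ih₁ ih₂ =>
    simp only [tr, TM2.stepAux]
    cases f (P.get V)
    · exact ih₂ V s
    · exact ih₁ V s
  | goto f => exact ⟨V, rfl, rfl⟩
  | halt => exact ⟨V, rfl, rfl⟩

end

variable {M N : ProbTM} {t u : ℕ} {μ : PMF Str}

theorem evals_liftCfg (P : Placement N M.K M.Lab M.St)
    (hP : ∀ b l, M.prog b (P.label l) = P.tr (N.prog b l)) {c : N.Cfg} (hc : N.Evals c t μ)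
    {F : M.K → Str} {V : M.St} (hV : P.get V = c.var) {ν : Str → PMF Str}
    (hexit : ∀ V' s, s N.outStack ∈ μ.support →
      M.Evals (TM2.stepAux P.exit V' (Function.extend P.stack s F)) u (ν (s N.outStack))) :
    M.Evals (P.liftCfg F V c) (t + u) (μ.bind ν) := by
  induction hc generalizing V with
  | halt v s t =>
    rw [PMF.pure_bind]
    exact (hexit V s ((PMF.mem_support_pure_iff _ _).2 rfl)).mono (Nat.le_add_left u t)
  | @step l v s t _ _ ih =>
    obtain rfl : P.get V = v := hV
    rw [PMF.bind_bind, Nat.add_right_comm]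
    refine .step fun b => ?_
    obtain ⟨V', hV', heq⟩ := P.exists_stepAux_tr_eq_liftCfg F (N.prog b l) V s
    rw [hP, heq]
    refine ih b hV' fun V'' s' hs' => hexit V'' s' ?_
    exact (PMF.mem_support_bind_iff _ _ _).2 ⟨b, by simp, hs'⟩

theorem evals (P : Placement N M.K M.Lab M.St)
    (hP : ∀ b l, M.prog b (P.label l) = P.tr (N.prog b l)) {l : N.Lab} {v : N.St} {s : N.K → Str}
    (h : N.Evals ⟨some l, v, s⟩ t μ) {V : M.St} {S : M.K → Str} (hV : P.get V = v)
    (hS : ∀ k, S (P.stack k) = s k) {ν : Str → PMF Str}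
    (hexit : ∀ V' S', S' (P.stack N.outStack) ∈ μ.support →
      (∀ k ∉ Set.range P.stack, S' k = S k) →
        M.Evals (TM2.stepAux P.exit V' S') u (ν (S' (P.stack N.outStack)))) :
    M.Evals ⟨some (P.label l), V, S⟩ (t + u) (μ.bind ν) := by
  have hS : Function.extend P.stack s S = S := by
    funext k
    by_cases hk : ∃ j, P.stack j = k
    · obtain ⟨j, rfl⟩ := hk
      rw [P.stack_injective.extend_apply, hS]
    · exact Function.extend_apply' _ _ _ hk
  have key := P.evals_liftCfg hP h (F := S) hV (u := u) (ν := ν) fun V' s' hs' => by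
    simpa only [P.stack_injective.extend_apply] using
      hexit V' (Function.extend P.stack s' S) (by rwa [P.stack_injective.extend_apply])
        fun k hk => Function.extend_apply' _ _ _ hk
  rwa [liftCfg, hS] at key

theorem evals_of_exit_eq_halt (P : Placement N M.K M.Lab M.St)
    (hP : ∀ b l, M.prog b (P.label l) = P.tr (N.prog b l)) (hexit : P.exit = .halt)
    (hout : P.stack N.outStack = M.outStack) {l : N.Lab} {v : N.St} {s : N.K → Str}
    (h : N.Evals ⟨some l, v, s⟩ t μ) {V : M.St} {S : M.K → Str} (hV : P.get V = v)
    (hS : ∀ k, S (P.stack k) = s k) : M.Evals ⟨some (P.label l), V, S⟩ t μ := by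
  have key := P.evals hP h hV hS (u := 0) (ν := PMF.pure) fun V' S' _ _ => by
    rw [hexit, hout]
    exact .halt V' S' 0
  rwa [PMF.bind_pure] at key

end Placement

theorem eval_le_eval_of_le (p : Polynomial ℕ) {m n : ℕ} (h : m ≤ n) : p.eval m ≤ p.eval n := by
  simp only [Polynomial.eval_eq_sum]
  exact Finset.sum_le_sum fun i _ => Nat.mul_le_mul_left _ (Nat.pow_le_pow_left h i)

theorem ProbTM.length_initCfg_le (M : ProbTM) (κ : ℕ) (z : M.K → Str) (x : Str) (k : M.K) :
    ((M.initCfg κ z x).stk k).length ≤ κ + x.length + (z k).length := by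
  simp only [initCfg]
  split_ifs
  · omega
  · rw [List.length_replicate]
    omega
  · omega

/-- The machine `M` with advice `z` computes the family `A` in polynomial time: the witnesses of
`IsNonuniformPPT` up to the polynomials. -/
def ProbTM.PolyComputes (M : ProbTM) (z : ℕ → M.K → Str) (A : ℕ → Str → PMF Str) : Prop :=
  ∃ a t : Polynomial ℕ, (∀ κ k, (z κ k).length ≤ a.eval κ) ∧
    ∀ κ x, M.OutputsWithin κ (z κ) x (t.eval (κ + x.length)) (A κ x)

theorem isNonuniformPPT_iff {A : ℕ → Str → PMF Str} :
    IsNonuniformPPT A ↔ ∃ (M : ProbTM) (z : ℕ → M.K → Str), M.PolyComputes z A :=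
  Iff.rfl

theorem IsNonuniformPPT.exists_length_le {A : ℕ → Str → PMF Str} (hA : IsNonuniformPPT A) :
    ∃ m : Polynomial ℕ, ∀ κ x, ∀ y ∈ (A κ x).support, y.length ≤ m.eval (κ + x.length) := by
  obtain ⟨M, z, a, t, ha, hM⟩ := hA
  refine ⟨.X + a + .C M.maxPushCount * t, fun κ x y hy => ?_⟩
  have hout := (ProbTM.outputsWithin_iff_evals.1 (hM κ x)).length_le hy
  have hinit := M.length_initCfg_le κ (z κ) x M.outStack
  have hadvice := (ha κ M.outStack).trans (eval_le_eval_of_le a (Nat.le_add_right κ x.length))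
  simp only [Polynomial.eval_add, Polynomial.eval_X, Polynomial.eval_mul, Polynomial.eval_C]
  omega

namespace ProbTM

/-- The first machine as a part of `seqTM A B`. When it halts, `B` starts. -/
def seqFst (A B : ProbTM) : Placement A (A.K ⊕ B.K) (A.Lab ⊕ B.Lab) (A.St × B.St) where
  stack := .inl
  stack_injective := Sum.inl_injective
  label := .inl
  get := Prod.fst
  set s v := (v, s.2)
  get_set _ _ := rfl
  exit := .load (fun s => (s.1, B.init)) (.goto fun _ => .inr B.start)

/-- The second machine as a part of `seqTM A B`. Its input stack is the output stack of the first
one, so that nothing has to be copied. -/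
def seqSnd (A B : ProbTM) : Placement B (A.K ⊕ B.K) (A.Lab ⊕ B.Lab) (A.St × B.St) where
  stack k := if k = B.inStack then .inl A.outStack else .inr k
  stack_injective k k' h := by
    dsimp only at h
    split_ifs at h <;> simp_all
  label := .inr
  get := Prod.snd
  set s v := (s.1, v)
  get_set _ _ := rfl
  exit := .halt

/-- The sequential composition of two machines: run `A`, then run `B` on its output. -/
def seqTM (A B : ProbTM) : ProbTM where
  K := A.K ⊕ B.K
  Lab := A.Lab ⊕ B.Lab
  St := A.St × B.St
  start := .inl A.start
  init := (A.init, B.init)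
  secStack := .inl A.secStack
  inStack := .inl A.inStack
  sec_ne_in := by simpa using A.sec_ne_in
  outStack := (seqSnd A B).stack B.outStack
  prog b := Sum.elim (fun l => (seqFst A B).tr (A.prog b l)) fun l => (seqSnd A B).tr (B.prog b l)

/-- The advice of `seqTM A B`. The security parameter is handed over to `B` as a part of it. -/
def seqAdvice (A B : ProbTM) (κ : ℕ) (zA : A.K → Str) (zB : B.K → Str) : (seqTM A B).K → Str :=
  Sum.elim zA (B.initCfg κ zB []).stk

theorem seqTM_outputsWithin {A B : ProbTM} {κ : ℕ} {zA : A.K → Str} {zB : B.K → Str} {x : Str}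
    {t u : ℕ} {μ : PMF Str} {ν : Str → PMF Str} (hA : A.OutputsWithin κ zA x t μ)
    (hB : ∀ y ∈ μ.support, B.OutputsWithin κ zB y u (ν y)) :
    (seqTM A B).OutputsWithin κ (seqAdvice A B κ zA zB) x (t + u) (μ.bind ν) := by
  rw [outputsWithin_iff_evals] at hA ⊢
  refine (seqFst A B).evals (M := seqTM A B) (fun _ _ => rfl) hA rfl ?_ fun V S hy hS => ?_
  · simp [initCfg, seqTM, seqFst, seqAdvice]
  have hB := outputsWithin_iff_evals.1 (hB _ hy)
  refine (seqSnd A B).evals_of_exit_eq_halt (M := seqTM A B) (fun _ _ => rfl) rfl rfl hB rfl ?_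
  intro k
  by_cases hk : k = B.inStack
  · simp [hk, seqSnd, seqFst]
  · have hk' : (.inr k : (seqTM A B).K) ∉ Set.range (seqFst A B).stack := by simp [seqFst]
    simpa [hk, seqSnd, initCfg, seqTM, seqAdvice] using hS _ hk'

theorem PolyComputes.seqTM {M N : ProbTM} {zM : ℕ → M.K → Str} {zN : ℕ → N.K → Str}
    {A B : ℕ → Str → PMF Str} (hA : M.PolyComputes zM A) (hB : N.PolyComputes zN B) :
    (seqTM M N).PolyComputes (fun κ => seqAdvice M N κ (zM κ) (zN κ))
      fun κ x => (A κ x).bind (B κ) := by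
  obtain ⟨m, hm⟩ := (isNonuniformPPT_iff.2 ⟨M, zM, hA⟩).exists_length_le
  obtain ⟨aM, tM, haM, hM⟩ := hA
  obtain ⟨aN, tN, haN, hN⟩ := hB
  refine ⟨aM + aN + .X, tM + tN.comp (.X + m), fun κ k => ?_, fun κ x => ?_⟩
  · simp only [Polynomial.eval_add, Polynomial.eval_X]
    rcases k with k | k
    · exact (haM κ k).trans (by omega)
    · refine (N.length_initCfg_le κ (zN κ) [] k).trans ?_
      have := haN κ k
      simp only [List.length_nil]
      omega
  · rw [Polynomial.eval_add, Polynomial.eval_comp, Polynomial.eval_add, Polynomial.eval_X]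
    refine seqTM_outputsWithin (hM κ x) fun y hy => ?_
    refine (hN κ y).mono (eval_le_eval_of_le tN ?_)
    have hy := hm κ x y hy
    omega

end ProbTM

theorem IsNonuniformPPT.comp {A B : ℕ → Str → PMF Str} (hA : IsNonuniformPPT A)
    (hB : IsNonuniformPPT B) : IsNonuniformPPT fun κ x => (A κ x).bind (B κ) := by
  obtain ⟨M, zM, hM⟩ := isNonuniformPPT_iff.1 hA
  obtain ⟨N, zN, hN⟩ := isNonuniformPPT_iff.1 hB
  exact isNonuniformPPT_iff.2 ⟨_, _, hM.seqTM hN⟩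

namespace ProbTM

/-- The machine that writes its input, reversed, on an output stack of its own. -/
def reverseTM : ProbTM where
  K := Fin 3
  Lab := Unit
  St := Option Bool
  start := ()
  init := none
  secStack := 1
  inStack := 0
  sec_ne_in := by simp
  outStack := 2
  prog _ _ := .pop 0 (fun _ a => a) <| .branch Option.isSome
    (.push 2 (fun s => s.getD false) (.goto fun _ => ())) .halt

theorem reverseTM_evals (v : Option Bool) (S : Fin 3 → Str) :
    reverseTM.Evals ⟨some (), v, S⟩ ((S 0).length + 1) (PMF.pure ((S 0).reverse ++ S 2)) := by
  generalize hx : S 0 = x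
  induction x generalizing v S with
  | nil =>
    have hstep (b : Bool) : TM2.stepAux (reverseTM.prog b ()) v S =
        (⟨none, none, Function.update S (0 : Fin 3) []⟩ : reverseTM.Cfg) := by
      simp [reverseTM, TM2.stepAux, hx]
    refine .step_const fun b => hstep b ▸ ?_
    exact .halt (M := reverseTM) none (Function.update S (0 : Fin 3) []) 0
  | cons d x ih =>
    have hstep (b : Bool) : TM2.stepAux (reverseTM.prog b ()) v S =
        (⟨some (), some d,
          Function.update (Function.update S (0 : Fin 3) x) (2 : Fin 3) (d :: S 2)⟩ :
            reverseTM.Cfg) := by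
      simp [reverseTM, TM2.stepAux, hx]
    have hrest : reverseTM.Evals ⟨some (), some d,
          Function.update (Function.update S (0 : Fin 3) x) (2 : Fin 3) (d :: S 2)⟩
        (x.length + 1) (PMF.pure ((d :: x).reverse ++ S 2)) := by
      rw [List.reverse_cons, List.append_assoc]
      exact ih (some d) (Function.update (Function.update S 0 x) 2 (d :: S 2)) rfl
    exact .step_const fun b => hstep b ▸ hrest

theorem reverseTM_polyComputes :
    reverseTM.PolyComputes (fun _ _ => []) fun _ x => PMF.pure x.reverse := by
  refine ⟨0, .X + 1, by simp, fun κ x => outputsWithin_iff_evals.2 ?_⟩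
  have := reverseTM_evals none (reverseTM.initCfg κ (fun _ => []) x).stk
  refine Evals.mono (by simpa [initCfg, reverseTM] using this) ?_
  simp

end ProbTM

/-- Reversing the output twice moves it to a fresh stack. -/
theorem IsNonuniformPPT.exists_outStack_eq_nil {A : ℕ → Str → PMF Str} (hA : IsNonuniformPPT A) :
    ∃ (M : ProbTM) (z : ℕ → M.K → Str), M.PolyComputes z A ∧
      ∀ κ x, (M.initCfg κ (z κ) x).stk M.outStack = [] := by
  have hrev : IsNonuniformPPT fun _ x => PMF.pure x.reverse :=
    isNonuniformPPT_iff.2 ⟨_, _, ProbTM.reverseTM_polyComputes⟩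
  obtain ⟨M, z, hM⟩ := isNonuniformPPT_iff.1 (hA.comp hrev)
  refine ⟨_, _, by simpa using hM.seqTM ProbTM.reverseTM_polyComputes, fun κ x => ?_⟩
  simp [ProbTM.seqTM, ProbTM.seqSnd, ProbTM.seqAdvice, ProbTM.initCfg, ProbTM.reverseTM]

/-- The coin whose probability of `true` has the given binary digits. The digits are compared with
fresh fair bits, and the first digit that differs from its bit decides: the coin compares a
uniformly random real number with its bias. -/
noncomputable def dyadicCoin : List Bool → PMF Bool
  | [] => PMF.pure false
  | d :: ds => (PMF.uniformOfFintype Bool).bind fun b => if b = d then dyadicCoin ds else PMF.pure d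

theorem toReal_dyadicCoin_cons (d : Bool) (ds : List Bool) :
    (dyadicCoin (d :: ds) true).toReal = (cond d 1 0 + (dyadicCoin ds true).toReal) / 2 := by
  have htop : (2⁻¹ * dyadicCoin ds true : ENNReal) ≠ ⊤ :=
    ENNReal.mul_ne_top (by simp) (PMF.apply_ne_top _ _)
  rw [dyadicCoin, PMF.bind_apply, tsum_bool]
  cases d
  · simp [div_eq_inv_mul]
  · simp [ENNReal.toReal_add, htop, div_eq_inv_mul, mul_add]

theorem exists_dyadicCoin_approx (n : ℕ) {r : ℝ} (h0 : 0 ≤ r) (h1 : r ≤ 1) :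
    ∃ ds, ds.length = n ∧ |(dyadicCoin ds true).toReal - r| ≤ (1 / 2) ^ n := by
  induction n generalizing r with
  | zero =>
    refine ⟨[], rfl, ?_⟩
    simpa [dyadicCoin, abs_of_nonneg h0] using h1
  | succ n ih =>
    suffices h : ∃ d : Bool, 0 ≤ 2 * r - cond d 1 0 ∧ 2 * r - cond d 1 0 ≤ 1 by
      obtain ⟨d, hd0, hd1⟩ := h
      obtain ⟨ds, hlen, hds⟩ := ih hd0 hd1
      refine ⟨d :: ds, by rw [List.length_cons, hlen], ?_⟩
      rw [abs_le] at hds ⊢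
      rw [toReal_dyadicCoin_cons, pow_succ]
      constructor <;> linarith
    rcases le_total (1 / 2) r with hr | hr
    · exact ⟨true, by rw [cond_true]; linarith, by rw [cond_true]; linarith⟩
    · exact ⟨false, by rw [cond_false]; linarith, by rw [cond_false]; linarith⟩

namespace ProbTM

/-- The stacks of `choiceTM` besides those of its parts: the input, the security parameter and the
output, and the digits of the bias of its coin. -/
inductive Port
  | input
  | security
  | output
  | digits
  deriving DecidableEq

instance : Fintype Port := ⟨{.input, .security, .output, .digits}, by rintro ⟨⟩ <;> simp⟩

/-- The machine `N b` as a part of `choiceTM N`. Both parts share the input and the output stack. -/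
def choicePart (N : Bool → ProbTM) (b : Bool) :
    Placement (N b) (Port ⊕ Σ b, (N b).K) (Option (Σ b, (N b).Lab))
      (Option Bool × ∀ b, (N b).St) where
  stack k := if k = (N b).inStack then .inl .input else
    if k = (N b).outStack then .inl .output else .inr ⟨b, k⟩
  stack_injective k k' h := by
    dsimp only at h
    split_ifs at h <;> simp_all
  label l := some ⟨b, l⟩
  get s := s.2 b
  set s v := (s.1, Function.update s.2 b v)
  get_set s v := Function.update_self b v s.2
  exit := .halt

/-- The machine that tosses the coin `dyadicCoin ds`, where `ds` is found on the stack `digits`,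
and then runs the machine `N b`, where `b` is the result. -/
def choiceTM (N : Bool → ProbTM) : ProbTM where
  K := Port ⊕ Σ b, (N b).K
  Lab := Option (Σ b, (N b).Lab)
  St := Option Bool × ∀ b, (N b).St
  start := none
  init := (none, fun b => (N b).init)
  secStack := .inl .security
  inStack := .inl .input
  sec_ne_in := by simp
  outStack := .inl .output
  prog c
    | none => .pop (.inl .digits) (fun s d => (d, s.2)) <| .branch (fun s => s.1 == some c)
        (.goto fun _ => none) (.goto fun s => some ⟨s.1.getD false, (N (s.1.getD false)).start⟩)
    | some ⟨b, l⟩ => (choicePart N b).tr ((N b).prog c l)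

/-- The advice of `choiceTM N`. The security parameter is handed over to the machines `N b` as a
part of it. -/
def choiceAdvice (N : Bool → ProbTM) (κ : ℕ) (z : ∀ b, (N b).K → Str) (ds : List Bool) :
    (choiceTM N).K → Str :=
  Sum.elim (fun k => if k = .digits then ds else [])
    fun i => ((N i.1).initCfg κ (z i.1) []).stk i.2

variable {N : Bool → ProbTM} {κ : ℕ} {z : ∀ b, (N b).K → Str} {x : Str} {t : ℕ}
  {ν : Bool → PMF Str}

theorem stepAux_choiceTM_prog_none (c : Bool) (o : Option Bool) (v : ∀ b, (N b).St)
    (S : Port ⊕ (Σ b, (N b).K) → Str) :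
    TM2.stepAux ((choiceTM N).prog c none) (o, v) S =
      (⟨some (if (S (.inl .digits)).head? = some c then none else
            some ⟨(S (.inl .digits)).head?.getD false, (N _).start⟩),
          ((S (.inl .digits)).head?, v),
        Function.update S (.inl .digits) (S (.inl .digits)).tail⟩ : (choiceTM N).Cfg) := by
  by_cases hc : (S (.inl .digits)).head? = some c
  · simp [choiceTM, TM2.stepAux, hc]
  · simp [choiceTM, TM2.stepAux, hc, beq_eq_false_iff_ne.2 hc]

theorem choiceTM_evals_toss {v : ∀ b, (N b).St} {S₀ : Port ⊕ (Σ b, (N b).K) → Str}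
    (h : ∀ b o S, (∀ k ≠ .inl .digits, S k = S₀ k) →
      (choiceTM N).Evals ⟨some (some ⟨b, (N b).start⟩), (o, v), S⟩ t (ν b))
    (ds : List Bool) (o : Option Bool) (S : Port ⊕ (Σ b, (N b).K) → Str)
    (hds : S (.inl .digits) = ds) (hS : ∀ k ≠ .inl .digits, S k = S₀ k) :
    (choiceTM N).Evals ⟨some none, (o, v), S⟩ (ds.length + 1 + t) ((dyadicCoin ds).bind ν) := by
  induction ds generalizing o S with
  | nil =>
    rw [dyadicCoin, PMF.pure_bind, Nat.add_right_comm]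
    refine .mono (.step_const fun c => ?_) (Nat.succ_le_succ (Nat.le_add_left t _))
    rw [stepAux_choiceTM_prog_none, hds]
    exact h false none _ fun k hk => (Function.update_of_ne hk _ S).trans (hS k hk)
  | cons d ds ih =>
    have hpop (k) (hk : k ≠ .inl .digits) : Function.update S (.inl .digits) ds k = S₀ k :=
      (Function.update_of_ne hk _ S).trans (hS k hk)
    rw [dyadicCoin, PMF.bind_bind, Nat.add_right_comm]
    refine .step fun c => ?_
    rw [stepAux_choiceTM_prog_none, hds]
    simp only [List.head?_cons, Option.some.injEq, Option.getD_some, List.tail_cons]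
    obtain rfl | hc := eq_or_ne c d
    · simp only [if_true]
      exact ih (some c) _ (Function.update_self _ _ _) hpop
    · simp only [hc, hc.symm, if_false, PMF.pure_bind]
      exact (h d (some d) _ hpop).mono (Nat.le_add_left t _)

theorem choiceTM_evals_part (hnil : ∀ b x, ((N b).initCfg κ (z b) x).stk (N b).outStack = [])
    {b : Bool} (hb : (N b).OutputsWithin κ (z b) x t (ν b)) (o : Option Bool) (ds : List Bool)
    {S : Port ⊕ (Σ b, (N b).K) → Str}
    (hS : ∀ k ≠ .inl .digits, S k = ((choiceTM N).initCfg κ (choiceAdvice N κ z ds) x).stk k) :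
    (choiceTM N).Evals ⟨some (some ⟨b, (N b).start⟩), (o, fun b => (N b).init), S⟩ t (ν b) := by
  have hne : (N b).outStack ≠ (N b).inStack := fun h => by
    simpa [initCfg, h] using hnil b [true]
  refine (choicePart N b).evals_of_exit_eq_halt (M := choiceTM N) (fun _ _ => rfl) rfl
    (by simp [choicePart, choiceTM, hne]) (outputsWithin_iff_evals.1 hb) rfl fun k => ?_
  by_cases hin : k = (N b).inStack
  · simp [hS, hin, choicePart, initCfg, choiceTM]
  by_cases hout : k = (N b).outStack
  · subst hout
    refine .trans ?_ (hnil b x).symm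
    simp [hS, hne, choicePart, initCfg, choiceTM, choiceAdvice]
  · simp [hS, hin, hout, choicePart, initCfg, choiceTM, choiceAdvice]

theorem choiceTM_outputsWithin
    (hnil : ∀ b x, ((N b).initCfg κ (z b) x).stk (N b).outStack = [])
    (hN : ∀ b, (N b).OutputsWithin κ (z b) x t (ν b)) (ds : List Bool) :
    (choiceTM N).OutputsWithin κ (choiceAdvice N κ z ds) x (ds.length + 1 + t)
      ((dyadicCoin ds).bind ν) :=
  outputsWithin_iff_evals.2 <| choiceTM_evals_toss
    (fun b o _ hS => choiceTM_evals_part hnil (hN b) o ds hS) ds none _ rfl fun _ _ => rfl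

end ProbTM

theorem IsNonuniformPPT.dyadicCoin_bind {A : Bool → ℕ → Str → PMF Str}
    (hA : ∀ b, IsNonuniformPPT (A b)) {d : ℕ → List Bool} {p : Polynomial ℕ}
    (hd : ∀ κ, (d κ).length ≤ p.eval κ) :
    IsNonuniformPPT fun κ x => (dyadicCoin (d κ)).bind fun b => A b κ x := by
  choose N z hN hnil using fun b => (hA b).exists_outStack_eq_nil
  choose a t ha ht using hN
  refine isNonuniformPPT_iff.2 ⟨.choiceTM N,
    fun κ => ProbTM.choiceAdvice N κ (fun b => z b κ) (d κ),
    p + (.X + a true + a false), p + 1 + (t true + t false), fun κ k => ?_, fun κ x => ?_⟩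
  · simp only [Polynomial.eval_add, Polynomial.eval_X]
    rcases k with k | ⟨b, k⟩
    · by_cases hk : k = .digits
      · simpa [ProbTM.choiceAdvice, hk] using le_add_right (hd κ)
      · simp [ProbTM.choiceAdvice, hk]
    · have hinit := (N b).length_initCfg_le κ (z b κ) [] k
      have hadvice := ha b κ k
      rw [List.length_nil] at hinit
      cases b <;> exact hinit.trans (by omega)
  · simp only [Polynomial.eval_add, Polynomial.eval_one]
    refine (ProbTM.choiceTM_outputsWithin (fun b => hnil b κ)
      (fun b => (ht b κ x).mono (?_ : _ ≤ (t true + t false).eval (κ + x.length))) (d κ)).mono ?_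
    · rw [Polynomial.eval_add]
      cases b <;> omega
    · have hdigits := (hd κ).trans (eval_le_eval_of_le p (Nat.le_add_right κ x.length))
      rw [Polynomial.eval_add]
      omega

theorem IsNonuniformPPT.exists_approx_coin_bind {A : Bool → ℕ → Str → PMF Str}
    (hA : ∀ b, IsNonuniformPPT (A b)) {r : ℝ} (h0 : 0 ≤ r) (h1 : r ≤ 1) :
    ∃ c : ℕ → PMF Bool, (∀ κ, |(c κ true).toReal - r| ≤ (1 / 2) ^ κ) ∧
      IsNonuniformPPT fun κ x => (c κ).bind fun b => A b κ x := by
  choose d hlen happrox using fun κ => exists_dyadicCoin_approx κ h0 h1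
  exact ⟨_, happrox, .dyadicCoin_bind hA (d := d) (p := .X) fun κ => by simp [hlen]⟩

theorem prOne_nonneg (A : Str → PMF Str) (μ : PMF Str) : 0 ≤ prOne A μ :=
  ENNReal.toReal_nonneg

theorem prOne_le_one (A : Str → PMF Str) (μ : PMF Str) : prOne A μ ≤ 1 :=
  ENNReal.toReal_le_of_le_ofReal zero_le_one (ENNReal.ofReal_one ▸ PMF.coe_le_one _ _)

theorem prOne_bind (A f : Str → PMF Str) (μ : PMF Str) :
    prOne A (μ.bind f) = prOne (fun x => (f x).bind A) μ := by
  rw [prOne, prOne, PMF.bind_bind]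

theorem toReal_apply_false (c : PMF Bool) : (c false).toReal = 1 - (c true).toReal := by
  have hsum := c.tsum_coe
  rw [tsum_bool] at hsum
  rw [eq_sub_iff_add_eq, ← ENNReal.toReal_add (PMF.apply_ne_top _ _) (PMF.apply_ne_top _ _), hsum,
    ENNReal.toReal_one]

theorem prOne_coin_bind (A : Str → PMF Str) (c : PMF Bool) (μ : Bool → PMF Str) :
    prOne A (c.bind μ) =
      (c true).toReal * prOne A (μ true) + (1 - (c true).toReal) * prOne A (μ false) := by
  rw [← toReal_apply_false, prOne, PMF.bind_bind, PMF.bind_apply, tsum_bool,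
    ENNReal.toReal_add (ENNReal.mul_ne_top (PMF.apply_ne_top _ _) (PMF.apply_ne_top _ _))
      (ENNReal.mul_ne_top (PMF.apply_ne_top _ _) (PMF.apply_ne_top _ _)),
    ENNReal.toReal_mul, ENNReal.toReal_mul, add_comm]
  rfl

theorem Negligible.abs {n : ℕ → ℝ} (h : Negligible n) : Negligible fun κ => |n κ| :=
  Asymptotics.SuperpolynomialDecay.trans_abs_le h fun κ => (abs_abs (n κ)).le

theorem Negligible.abs_add_abs {n₁ n₂ : ℕ → ℝ} (h₁ : Negligible n₁) (h₂ : Negligible n₂) :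
    Negligible fun κ => |n₁ κ| + |n₂ κ| :=
  h₁.abs.add h₂.abs

theorem negligible_pow_of_lt_one {r : ℝ} (h0 : 0 ≤ r) (h1 : r < 1) : Negligible fun κ => r ^ κ :=
  fun n => tendsto_pow_const_mul_const_pow_of_lt_one n h0 h1

theorem prOne_coin_bind_le {A : Str → PMF Str} {e n₁ n₂ : ℝ} {μ₁ μ₂ ν₁ ν₂ : PMF Str}
    (h₁ : prOne A μ₁ ≤ e * prOne A ν₁ + n₁) (h₂ : prOne A μ₂ ≤ e * prOne A ν₂ + n₂)
    (c : PMF Bool) :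
    prOne A (c.bind fun b => cond b μ₁ μ₂) ≤
      e * prOne A (c.bind fun b => cond b ν₁ ν₂) + (|n₁| + |n₂|) := by
  have hscale {q x y n : ℝ} (hq0 : 0 ≤ q) (hq1 : q ≤ 1) (h : x ≤ e * y + n) :
      q * x ≤ e * (q * y) + |n| :=
    calc
      q * x ≤ q * (e * y + n) := mul_le_mul_of_nonneg_left h hq0
      _ = e * (q * y) + q * n := by ring
      _ ≤ e * (q * y) + q * |n| := by gcongr; exact le_abs_self n
      _ ≤ e * (q * y) + |n| := by gcongr; exact mul_le_of_le_one_left (abs_nonneg n) hq1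
  have hq0 (b : Bool) : 0 ≤ (c b).toReal := ENNReal.toReal_nonneg
  have hsum := toReal_apply_false c
  rw [prOne_coin_bind, prOne_coin_bind, ← hsum, cond_true, cond_true, cond_false, cond_false]
  linarith [hscale (hq0 true) (by linarith [hq0 false]) h₁,
    hscale (hq0 false) (by linarith [hq0 true]) h₂]

theorem abs_prOne_coin_bind_sub_le (A : Str → PMF Str) (c c' : PMF Bool) (μ : Bool → PMF Str) :
    |prOne A (c.bind μ) - prOne A (c'.bind μ)| ≤ |(c true).toReal - (c' true).toReal| := by
  have hμ : |prOne A (μ true) - prOne A (μ false)| ≤ 1 :=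
    abs_sub_le_of_nonneg_of_le (prOne_nonneg _ _) (prOne_le_one _ _) (prOne_nonneg _ _)
      (prOne_le_one _ _)
  calc
    _ = |(c true).toReal - (c' true).toReal| * |prOne A (μ true) - prOne A (μ false)| := by
      rw [prOne_coin_bind, prOne_coin_bind, ← abs_mul]
      ring_nf
    _ ≤ _ := mul_le_of_le_one_right (abs_nonneg _) hμ

theorem indist_iff {ε : ℝ} {μ ν : PMF Str} : Indist ε μ ν ↔
    ∀ x, μ x ≤ ENNReal.ofReal (Real.exp ε) * ν x ∧ ν x ≤ ENNReal.ofReal (Real.exp ε) * μ x := by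
  refine ⟨fun h x => by
    simpa only [PMF.toOuterMeasure_apply_singleton] using h {x}, fun h S => ?_⟩
  simp only [PMF.toOuterMeasure_apply, ← ENNReal.tsum_mul_left]
  constructor <;> refine ENNReal.tsum_le_tsum fun x => ?_ <;> by_cases hx : x ∈ S <;>
    simp [hx, h x]

theorem Indist.bind {ε : ℝ} {μ ν : PMF Str} (h : Indist ε μ ν) (f : Str → PMF Str) :
    Indist ε (μ.bind f) (ν.bind f) := by
  rw [indist_iff] at h ⊢
  intro y
  simp only [PMF.bind_apply, ← ENNReal.tsum_mul_left, ← mul_assoc]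
  exact ⟨ENNReal.tsum_le_tsum fun x => mul_le_mul_left (h x).1 _,
    ENNReal.tsum_le_tsum fun x => mul_le_mul_left (h x).2 _⟩

theorem Indist.bind_right {α : Type*} {ε : ℝ} {μ ν : α → PMF Str} (h : ∀ a, Indist ε (μ a) (ν a))
    (c : PMF α) : Indist ε (c.bind μ) (c.bind ν) := by
  simp only [indist_iff] at h ⊢
  intro y
  simp only [PMF.bind_apply, ← ENNReal.tsum_mul_left, mul_left_comm _ (c _)]
  exact ⟨ENNReal.tsum_le_tsum fun a => mul_le_mul_right (h a y).1 _,
    ENNReal.tsum_le_tsum fun a => mul_le_mul_right (h a y).2 _⟩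

theorem toReal_biasedCoin_true (p : unitInterval) : (biasedCoin p true).toReal = p :=
  ENNReal.toReal_ofReal p.2.1

section

variable {T : Type*} {ε : ℕ → ℝ}

theorem IsDP.mix {M₁ M₂ : Mech T} {κ : ℕ} {δ : ℝ} (h₁ : IsDP δ (M₁ κ)) (h₂ : IsDP δ (M₂ κ))
    (p : unitInterval) : IsDP δ (mix p M₁ M₂ κ) := fun D₁ D₂ hD =>
  Indist.bind_right (Bool.rec (h₂ D₁ D₂ hD) (h₁ D₁ D₂ hD)) _

theorem convexity_indCDP : SatisfiesConvexity (IndCDP (T := T) ε) := by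
  rintro M₁ M₂ ⟨n₁, hn₁, h₁⟩ ⟨n₂, hn₂, h₂⟩ p
  refine ⟨_, hn₁.abs_add_abs hn₂, fun A hA P => ?_⟩
  filter_upwards [h₁ A hA P, h₂ A hA P] with κ h₁ h₂ D₁ D₂ hD₁ hD₂ hD
  exact prOne_coin_bind_le (h₁ D₁ D₂ hD₁ hD₂ hD) (h₂ D₁ D₂ hD₁ hD₂ hD) (biasedCoin p)

theorem postProcessing_indCDP : SatisfiesPPTPostProcessing (IndCDP (T := T) ε) := by
  rintro M ⟨n, hn, h⟩ f hf
  refine ⟨n, hn, fun A hA P => ?_⟩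
  simpa only [postProcess, prOne_bind] using h _ (hf.comp hA) P

theorem convexity_simCDP : SatisfiesConvexity (SimCDP (T := T) ε) := by
  rintro M₁ M₂ ⟨M₁', hDP₁, n₁, hn₁, h₁⟩ ⟨M₂', hDP₂, n₂, hn₂, h₂⟩ p
  refine ⟨mix p M₁' M₂', fun κ => (hDP₁ κ).mix (hDP₂ κ) p, _, hn₁.abs_add_abs hn₂,
    fun A hA P => ?_⟩
  filter_upwards [h₁ A hA P, h₂ A hA P] with κ h₁ h₂ D hD
  have hsub {x y n : ℝ} : x - y ≤ n ↔ x ≤ 1 * y + n := by rw [one_mul, sub_le_iff_le_add']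
  exact hsub.2 (prOne_coin_bind_le (hsub.1 (h₁ D hD)) (hsub.1 (h₂ D hD)) (biasedCoin p))

theorem postProcessing_simCDP : SatisfiesPPTPostProcessing (SimCDP (T := T) ε) := by
  rintro M ⟨M', hDP, n, hn, h⟩ f hf
  refine ⟨postProcess f M', fun κ D₁ D₂ hD => (hDP κ D₁ D₂ hD).bind (f κ), n, hn, fun A hA P => ?_⟩
  simpa only [postProcess, prOne_bind] using h _ (hf.comp hA) P

theorem postProcessing_czkPrivate (Agg : Set (Mech T)) :
    SatisfiesPPTPostProcessing (CZKPrivate Agg ε) := by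
  rintro M ⟨agg, hagg, S, hS, n, hn, h⟩ f hf
  refine ⟨agg, hagg, _, hS.comp hf, n, hn, fun A hA P => ?_⟩
  simpa only [postProcess, prOne_bind, PMF.bind_bind] using h _ (hf.comp hA) P

theorem convexity_czkPrivate {Agg : Set (Mech T)} (hAgg : AggDirected Agg) :
    SatisfiesConvexity (CZKPrivate Agg ε) := by
  rintro M₁ M₂ ⟨a₁, ha₁, S₁, hS₁, n₁, hn₁, h₁⟩ ⟨a₂, ha₂, S₂, hS₂, n₂, hn₂, h₂⟩ p
  obtain ⟨a, ha, g₁, g₂, hg₁, hg₂, hg⟩ := hAgg a₁ ha₁ a₂ ha₂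
  let S (b : Bool) (κ : ℕ) (x : Str) : PMF Str :=
    cond b ((g₁ κ x).bind (S₁ κ)) ((g₂ κ x).bind (S₂ κ))
  have hS : ∀ b, IsNonuniformPPT (S b) := Bool.rec (hg₂.comp hS₂) (hg₁.comp hS₁)
  obtain ⟨c, hc, hSc⟩ := IsNonuniformPPT.exists_approx_coin_bind hS p.2.1 p.2.2
  have hsim κ D : (a κ D).bind (fun x => (c κ).bind fun b => S b κ x) =
      (c κ).bind fun b => cond b ((a₁ κ D).bind (S₁ κ)) ((a₂ κ D).bind (S₂ κ)) := by
    rw [PMF.bind_comm, ← (hg κ D).1, ← (hg κ D).2, PMF.bind_bind, PMF.bind_bind]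
    congr 1
    funext b
    cases b <;> rfl
  refine ⟨a, ha, _, hSc, fun κ => |n₁ κ| + |n₂ κ| + (1 / 2) ^ κ,
    (hn₁.abs_add_abs hn₂).add (negligible_pow_of_lt_one (by norm_num) (by norm_num)),
    fun A hA P => ?_⟩
  filter_upwards [h₁ A hA P, h₂ A hA P] with κ h₁ h₂ D₁ D₂ hD₁ hD₂ hD
  obtain ⟨h₁, h₁'⟩ := h₁ D₁ D₂ hD₁ hD₂ hD
  obtain ⟨h₂, h₂'⟩ := h₂ D₁ D₂ hD₁ hD₂ hD
  have happrox (μ : Bool → PMF Str) :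
      |prOne (A κ) ((c κ).bind μ) - prOne (A κ) ((biasedCoin p).bind μ)| ≤ (1 / 2) ^ κ :=
    (abs_prOne_coin_bind_sub_le _ _ _ _).trans (by rw [toReal_biasedCoin_true]; exact hc κ)
  rw [hsim, mix]
  constructor
  · have hle := prOne_coin_bind_le h₁ h₂ (c κ)
    have hmech := abs_le.1 (happrox fun b => cond b (M₁ κ D₁) (M₂ κ D₁))
    linarith
  · have hle := prOne_coin_bind_le h₁' h₂' (biasedCoin p)
    have hsimul := abs_le.1 <|
      happrox fun b => cond b ((a₁ κ D₂).bind (S₁ κ)) ((a₂ κ D₂).bind (S₂ κ))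
    linarith

end

end CompDP

theorem mainTheorem7 {T : Type*} (ε : ℕ → ℝ) :
    (CompDP.SatisfiesConvexity (CompDP.IndCDP (T := T) ε) ∧
      CompDP.SatisfiesPPTPostProcessing (CompDP.IndCDP (T := T) ε)) ∧
    (CompDP.SatisfiesConvexity (CompDP.SimCDP (T := T) ε) ∧
      CompDP.SatisfiesPPTPostProcessing (CompDP.SimCDP (T := T) ε)) ∧
    (∀ Agg : Set (CompDP.Mech T),
      (CompDP.AggDirected Agg → CompDP.SatisfiesConvexity (CompDP.CZKPrivate Agg ε)) ∧
      CompDP.SatisfiesPPTPostProcessing (CompDP.CZKPrivate Agg ε)) :=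
  ⟨⟨CompDP.convexity_indCDP, CompDP.postProcessing_indCDP⟩,
    ⟨CompDP.convexity_simCDP, CompDP.postProcessing_simCDP⟩,
    fun Agg => ⟨CompDP.convexity_czkPrivate, CompDP.postProcessing_czkPrivate Agg⟩⟩
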